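/- **Theorem (Existence of $X$-space-regularised minimisers).** Let $(X,\mathsf d)$ be a complete separable metric space; write $\mathcal M(Z)$ for the set of finite nonnegative Radon measures on $Z$. Let $F:[0,\infty)\to[0,\infty]$ be convex and lower semicontinuous, with recession constant $F'_\infty:=\lim_{s\to\infty}F(s)/s\in[0,\infty]$. For $\gamma,\mu\in\mathcal M(Z)$ with Lebesgue decomposition $\gamma=\sigma\mu+\gamma^\perp$ put $$\mathcal F(\gamma\mid\mu):=\int_Z F(\sigma)\,d\mu+F'_\infty\,\gamma^\perp(Z)\qquad(\infty\cdot 0:=0).$$ Let $c:X\times X\to(-\infty,+\infty]$ be lower semicontinuous and bounded below, let $\varepsilon>0$, and assume that at least one of the following holds: (a) $F'_\infty=+\infty$ (for example the Kullback–Leibler entropy $F(s)=s\log s-s+1$); (b) the sublevel sets $\{c\le k\}$, $k\in\mathbb R$, are compact, and $(2+\varepsilon)F'_\infty+\inf_{X\times X}c>0$. Let $\mu_0,\mu_1\in\mathcal M(X)$ and $\nu_X\in\mathcal M(X\times X)$. Then the problem $$\mathrm{UOT}_{X,\varepsilon}(\mu_0,\mu_1):=\inf_{\gamma\in\mathcal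 M(X\times X)}\Big\{\mathcal F(\gamma_0\mid\mu_0)+\mathcal F(\gamma_1\mid\mu_1)+\int_{X\times X}c\,d\gamma+\varepsilon\,\mathcal F(\gamma\mid\nu_X)\Big\},$$ where $\gamma_0,\gamma_1$ are the marginals of $\gamma$, has at least one minimiser: there is $\gamma_\varepsilon\in\mathcal M(X\times X)$ at which the functional in braces equals $\mathrm{UOT}_{X,\varepsilon}(\mu_0,\mu_1)$. -/

import Mathlib

open MeasureTheory Filter Topology
open scoped NNReal ENNReal

namespace UnbalancedOT

noncomputable section

/-- The recession constant `F'_∞ = lim_{s → ∞} F(s) / s` of a function `F : [0,∞) → [0,∞]`.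
For a convex `F` the limit exists in `[0,∞]`, so it equals the upper limit used here. -/
def recession (F : ℝ≥0 → ℝ≥0∞) : ℝ≥0∞ :=
  limsup (fun s : ℝ≥0 => F s / (s : ℝ≥0∞)) atTop

/-- The relative entropy `𝓕(γ | μ) = ∫ F(σ) dμ + F'_∞ γ^⊥(Z)`, where `γ = σ μ + γ^⊥` is the
Lebesgue decomposition of `γ` with respect to `μ` (with the convention `∞ · 0 = 0`).
The density `σ` is finite `μ`-almost everywhere. -/
def relEntropy {Z : Type*} [MeasurableSpace Z] (F : ℝ≥0 → ℝ≥0∞) (γ μ : Measure Z) : ℝ≥0∞ :=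
  (∫⁻ z, F (γ.rnDeriv μ z).toNNReal ∂μ) + recession F * γ.singularPart μ Set.univ

/-- The linear cost `(c, γ) = ∫ c dγ ∈ [-∞,∞]`, as the integral of the positive part of `c` minus
that of its negative part. It is used for `c` bounded below and `γ` finite only, so that the
second integral is finite. -/
def linearCost {Z : Type*} [MeasurableSpace Z] (c : Z → EReal) (γ : Measure Z) : EReal :=
  ((∫⁻ z, (c z).toENNReal ∂γ : ℝ≥0∞) : EReal) - ((∫⁻ z, (-c z).toENNReal ∂γ : ℝ≥0∞) : EReal)

variable {X : Type*} [MeasurableSpace X]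

/-- The primal functional `𝓔(γ | μ₀, μ₁) = 𝓕(γ₀ | μ₀) + 𝓕(γ₁ | μ₁) + (c, γ)`,
with `γ₀, γ₁` the marginals of `γ`. -/
def primal (F : ℝ≥0 → ℝ≥0∞) (c : X × X → EReal) (μ₀ μ₁ : FiniteMeasure X)
    (γ : FiniteMeasure (X × X)) : EReal :=
  (relEntropy F (γ : Measure (X × X)).fst (μ₀ : Measure X) : EReal)
    + (relEntropy F (γ : Measure (X × X)).snd (μ₁ : Measure X) : EReal)
    + linearCost c (γ : Measure (X × X))

/-- The regularised functional `𝓔_ε(γ | μ₀, μ₁, ν) = 𝓔(γ | μ₀, μ₁) + ε 𝓕(γ | ν)`. -/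
def primalReg (F : ℝ≥0 → ℝ≥0∞) (c : X × X → EReal) (ε : ℝ) (μ₀ μ₁ : FiniteMeasure X)
    (ν : FiniteMeasure (X × X)) (γ : FiniteMeasure (X × X)) : EReal :=
  primal F c μ₀ μ₁ γ
    + (ε : EReal) * (relEntropy F (γ : Measure (X × X)) (ν : Measure (X × X)) : EReal)

/-- The value `UOT_{X,ε}(μ₀, μ₁) = inf_γ 𝓔_ε(γ | μ₀, μ₁, ν)`, over all finite measures `γ`. -/
def UOTReg (F : ℝ≥0 → ℝ≥0∞) (c : X × X → EReal) (ε : ℝ) (μ₀ μ₁ : FiniteMeasure X)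
    (ν : FiniteMeasure (X × X)) : EReal :=
  ⨅ γ : FiniteMeasure (X × X), primalReg F c ε μ₀ μ₁ ν γ

end

end UnbalancedOT

/-!
Fenchel duality expresses the relative entropy `𝓕(γ | μ)` as the supremum of `∫ A dγ + ∫ B dμ` over
pairs `(A, B)` of functions whose values are coefficients of affine minorants of `F`. The set of
these coefficients is convex, so measurable pairs can be replaced by continuous ones, and `𝓕(· | μ)`
is a supremum of weakly continuous functionals. The transport term is lower semicontinuous because
`c` is an increasing limit of Lipschitz functions.

Constant `A` and `B` give `𝓕(γ | μ) ≥ a γ(Z) + b μ(Z)`, where the slope `a` may be any number below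
`F'_∞`. The three entropies together contribute `(2 + ε) a` per unit mass of `γ`, so the coercivity
condition bounds the mass on sublevels. Sublevels are moreover tight: for superlinear `F` the
entropies of the marginals do not let mass escape to where `μ₀` and `μ₁` have little, and otherwise
the compact sublevels of `c` confine it. Prokhorov's theorem and the direct method finish the proof.
-/

namespace UnbalancedOT

/-- The coefficients `(a, b)` of the affine functions `s ↦ a s + b` lying below `F`, that is, the
pairs with `b ≤ -F*(a)` for the convex conjugate `F*` (a negative value of `a s + b` is no
constraint, as `F ≥ 0`). -/
def affineMinorants (F : ℝ≥0 → ℝ≥0∞) : Set (ℝ × ℝ) :=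
  {p | ∀ s : ℝ≥0, ENNReal.ofReal (p.1 * s + p.2) ≤ F s}

/-- The lower semicontinuous perspective of `F`: for convex lower semicontinuous `F` it is
`t F(s / t)` at `t > 0` and `F'_∞ s` at `t = 0`. It is defined as the support function of the
affine minorants, which is jointly sublinear in `(s, t)`. -/
noncomputable def perspective (F : ℝ≥0 → ℝ≥0∞) (s t : ℝ≥0) : ℝ≥0∞ :=
  ⨆ p : affineMinorants F, ENNReal.ofReal (p.1.1 * s + p.1.2 * t)

section Duality

variable {F : ℝ≥0 → ℝ≥0∞}

theorem mem_affineMinorants_iff {p : ℝ × ℝ} :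
    p ∈ affineMinorants F ↔ ∀ s t : ℝ≥0, F s ≤ t → p.1 * s + p.2 ≤ t := by
  refine ⟨fun hp s t hst => ?_, fun h s => ?_⟩
  · simpa using (ENNReal.ofReal_le_iff_le_toReal ENNReal.coe_ne_top).1 ((hp s).trans hst)
  · rcases eq_or_ne (F s) ⊤ with hs | hs
    · simp [hs]
    · exact ENNReal.ofReal_le_of_le_toReal (h s (F s).toNNReal (ENNReal.coe_toNNReal hs).ge)

theorem zero_mem_affineMinorants : (0 : ℝ × ℝ) ∈ affineMinorants F := fun s => by simp

theorem convex_affineMinorants : Convex ℝ (affineMinorants F) := by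
  intro p hp q hq a b ha hb hab
  rw [mem_affineMinorants_iff] at *
  intro s t hst
  calc (a • p + b • q).1 * s + (a • p + b • q).2
      = a * (p.1 * s + p.2) + b * (q.1 * s + q.2) := by
        simp only [Prod.fst_add, Prod.snd_add, Prod.smul_fst, Prod.smul_snd, smul_eq_mul]; ring
    _ ≤ a * t + b * t := by gcongr; exacts [hp s t hst, hq s t hst]
    _ = t := by rw [← add_mul, hab, one_mul]

/-- The epigraph of `F` without its points at infinite height, as a subset of the plane. -/
def realEpigraph (F : ℝ≥0 → ℝ≥0∞) : Set (ℝ × ℝ) :=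
  Prod.map (↑) (↑) '' {p : ℝ≥0 × ℝ≥0 | F p.1 ≤ p.2}

theorem isClosed_realEpigraph (hF : LowerSemicontinuous F) : IsClosed (realEpigraph F) := by
  have hclosed : IsClosed {p : ℝ≥0 × ℝ≥0 | F p.1 ≤ p.2} :=
    hF.isClosed_epigraph.preimage
      (continuous_fst.prodMk (ENNReal.continuous_coe.comp continuous_snd))
  exact (NNReal.isClosedEmbedding_coe.prodMap NNReal.isClosedEmbedding_coe).isClosedMap _ hclosed

theorem convex_realEpigraph (hF : ConvexOn ℝ≥0 Set.univ F) : Convex ℝ (realEpigraph F) := by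
  rintro _ ⟨⟨s, t⟩, hst, rfl⟩ _ ⟨⟨s', t'⟩, hst', rfl⟩ a b ha hb hab
  lift a to ℝ≥0 using ha
  lift b to ℝ≥0 using hb
  refine ⟨(a * s + b * s', a * t + b * t'), ?_, by simp⟩
  calc F (a * s + b * s') ≤ a • F s + b • F s' :=
        hF.2 (Set.mem_univ s) (Set.mem_univ s') zero_le zero_le (mod_cast hab)
    _ ≤ a • (t : ℝ≥0∞) + b • (t' : ℝ≥0∞) := by gcongr <;> assumption
    _ = ((a * t + b * t' : ℝ≥0) : ℝ≥0∞) := by push_cast [ENNReal.smul_def, smul_eq_mul]; rfl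

theorem exists_separating_line (hconv : ConvexOn ℝ≥0 Set.univ F) (hlsc : LowerSemicontinuous F)
    {s₀ y : ℝ≥0} (hy : y < F s₀) :
    ∃ α β u : ℝ, 0 ≤ β ∧ α * s₀ + β * y < u ∧ ∀ s t : ℝ≥0, F s ≤ t → u < α * s + β * t := by
  by_cases hproper : ∃ s t : ℝ≥0, F s ≤ t
  swap
  · push Not at hproper
    exact ⟨0, 0, 1, le_rfl, by simp, fun s t hst => absurd (hproper s t) hst.not_gt⟩
  obtain ⟨s₁, t₁, h₁⟩ := hproper
  have hnot : ((s₀ : ℝ), (y : ℝ)) ∉ realEpigraph F := by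
    rintro ⟨⟨s, t⟩, hst, heq⟩
    obtain ⟨rfl, rfl⟩ : s = s₀ ∧ t = y := by simpa using heq
    exact hst.not_gt hy
  obtain ⟨f, u, hu₀, hu⟩ := geometric_hahn_banach_point_closed (convex_realEpigraph hconv)
    (isClosed_realEpigraph hlsc) hnot
  have hf (s t : ℝ) : f (s, t) = f (1, 0) * s + f (0, 1) * t := by
    have : ((s, t) : ℝ × ℝ) = s • (1, 0) + t • (0, 1) := by ext <;> simp
    rw [this, map_add, map_smul, map_smul, smul_eq_mul, smul_eq_mul, mul_comm, mul_comm t]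
  have hline (s t : ℝ≥0) (hst : F s ≤ t) : u < f (1, 0) * s + f (0, 1) * t :=
    hf s t ▸ hu _ ⟨(s, t), hst, rfl⟩
  refine ⟨f (1, 0), f (0, 1), u, ?_, hf s₀ y ▸ hu₀, hline⟩
  -- Moving up along a vertical half-line of the epigraph must not cross the separating line.
  by_contra! hneg
  obtain ⟨n, hn⟩ := exists_nat_gt ((u - (f (1, 0) * s₁ + f (0, 1) * t₁)) / f (0, 1))
  have h := hline s₁ (t₁ + n) (h₁.trans (mod_cast le_self_add))
  rw [div_lt_iff_of_neg hneg] at hn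
  push_cast at h
  linarith

theorem exists_affineMinorant_lt (hconv : ConvexOn ℝ≥0 Set.univ F) (hlsc : LowerSemicontinuous F)
    {s₀ y : ℝ≥0} (hy : y < F s₀) : ∃ p ∈ affineMinorants F, y < p.1 * s₀ + p.2 := by
  simp only [mem_affineMinorants_iff]
  obtain ⟨α, β, u, hβ, hu₀, hu⟩ := exists_separating_line hconv hlsc hy
  rcases hβ.eq_or_lt with rfl | hβ
  · -- A vertical line bounds the domain of `F`: beyond it, minorants may be arbitrarily steep.
    simp only [zero_mul, add_zero] at hu₀ hu
    have hd : 0 < u - α * s₀ := sub_pos.2 hu₀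
    set k := (y + 1) / (u - α * s₀)
    have hk : 0 ≤ k := by positivity
    have hky : k * (u - α * s₀) = y + 1 := div_mul_cancel₀ _ hd.ne'
    refine ⟨(-(k * α), k * u), fun s t hst => ?_, ?_⟩
    · have := mul_nonneg hk (sub_nonneg.2 (hu s t hst).le)
      dsimp only
      linarith [t.coe_nonneg]
    · dsimp only
      linarith
  · have hline (s : ℝ) : -(α / β) * s + u / β = (u - α * s) / β := by ring
    refine ⟨(-(α / β), u / β), fun s t hst => ?_, ?_⟩
    · dsimp only
      rw [hline, div_le_iff₀ hβ]
      linarith [hu s t hst]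
    · dsimp only
      rw [hline, lt_div_iff₀ hβ]
      linarith

theorem perspective_one_right (hconv : ConvexOn ℝ≥0 Set.univ F) (hlsc : LowerSemicontinuous F)
    (s : ℝ≥0) : perspective F s 1 = F s := by
  refine le_antisymm (iSup_le fun p => by simpa using p.2 s) (le_of_forall_lt fun y hy => ?_)
  lift y to ℝ≥0 using hy.ne_top
  obtain ⟨p, hp, hlt⟩ := exists_affineMinorant_lt hconv hlsc hy
  refine lt_iSup_iff.2 ⟨⟨p, hp⟩, ?_⟩
  simpa [ENNReal.lt_ofReal_iff_toReal_lt] using hlt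

theorem perspective_add_le (s s' t t' : ℝ≥0) :
    perspective F (s + s') (t + t') ≤ perspective F s t + perspective F s' t' := by
  refine iSup_le fun p => ?_
  calc ENNReal.ofReal (p.1.1 * ↑(s + s') + p.1.2 * ↑(t + t'))
      = ENNReal.ofReal ((p.1.1 * s + p.1.2 * t) + (p.1.1 * s' + p.1.2 * t')) := by
        push_cast; ring_nf
    _ ≤ _ := ENNReal.ofReal_add_le
    _ ≤ perspective F s t + perspective F s' t' :=
        add_le_add (le_iSup_of_le p le_rfl) (le_iSup_of_le p le_rfl)

theorem perspective_mul (k s t : ℝ≥0) :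
    perspective F (k * s) (k * t) = k * perspective F s t := by
  simp only [perspective, ENNReal.mul_iSup]
  refine iSup_congr fun p => ?_
  rw [← ENNReal.ofReal_coe_nnreal, ← ENNReal.ofReal_mul k.coe_nonneg]
  push_cast
  ring_nf

theorem ofReal_slope_le_recession {p : ℝ × ℝ} (hp : p ∈ affineMinorants F) :
    ENNReal.ofReal p.1 ≤ recession F := by
  have hlim : Tendsto (fun s : ℝ≥0 => ENNReal.ofReal (p.1 + p.2 / s)) atTop
      (𝓝 (ENNReal.ofReal p.1)) := by
    refine ENNReal.tendsto_ofReal ?_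
    have : Tendsto (fun s : ℝ≥0 => p.2 / (s : ℝ)) atTop (𝓝 0) :=
      Tendsto.div_atTop tendsto_const_nhds (NNReal.tendsto_coe_atTop.2 tendsto_id)
    simpa using this.const_add p.1
  rw [← hlim.limsup_eq]
  refine limsup_le_limsup ?_
  filter_upwards [eventually_gt_atTop 0] with s hs
  have hs' : (0 : ℝ) < s := hs
  rw [ENNReal.le_div_iff_mul_le (Or.inl (mod_cast hs.ne')) (Or.inl ENNReal.coe_ne_top),
    ← ENNReal.ofReal_coe_nnreal, ← ENNReal.ofReal_mul' s.coe_nonneg]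
  simpa [add_mul, hs'.ne'] using hp s

theorem recession_le_perspective (hconv : ConvexOn ℝ≥0 Set.univ F)
    (hlsc : LowerSemicontinuous F) : recession F ≤ perspective F 1 0 := by
  by_cases htop : ∀ s, F s = ⊤
  · refine le_of_forall_lt fun r hr => ?_
    lift r to ℝ≥0 using hr.ne_top
    refine lt_iSup_iff.2 ⟨⟨(r + 1, 0), fun s => by simp [htop]⟩, ?_⟩
    simp [ENNReal.lt_ofReal_iff_toReal_lt]
  push Not at htop
  obtain ⟨s₁, hs₁⟩ := htop
  set r := perspective F 1 0
  have hgrowth (s : ℝ≥0) : F (s₁ + s) ≤ F s₁ + s * r := by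
    have h := perspective_add_le (F := F) s₁ (s * 1) 1 (s * 0)
    rwa [perspective_mul, mul_zero, add_zero, mul_one, perspective_one_right hconv hlsc,
      perspective_one_right hconv hlsc] at h
  have hlim : Tendsto (fun s : ℝ≥0 => F s₁ / s + r) atTop (𝓝 r) := by
    have hs : Tendsto (fun s : ℝ≥0 => (s : ℝ≥0∞)) atTop (𝓝 ⊤) :=
      ENNReal.tendsto_coe_nhds_top.2 tendsto_id
    simpa using (ENNReal.Tendsto.const_div hs (Or.inr hs₁)).add_const r
  rw [← hlim.limsup_eq]
  refine limsup_le_limsup ?_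
  filter_upwards [eventually_ge_atTop s₁, eventually_gt_atTop 0] with s hs hs0
  have hF : F s ≤ F s₁ + s * r := by
    obtain ⟨d, rfl⟩ := exists_add_of_le hs
    refine (hgrowth d).trans ?_
    gcongr
    exact le_add_self
  calc F s / s ≤ (F s₁ + s * r) / s := by gcongr
    _ = F s₁ / s + r := by
      rw [ENNReal.add_div, mul_comm, ENNReal.mul_div_cancel_right (mod_cast hs0.ne')
        ENNReal.coe_ne_top]

theorem perspective_one_zero (hconv : ConvexOn ℝ≥0 Set.univ F) (hlsc : LowerSemicontinuous F) :
    perspective F 1 0 = recession F :=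
  le_antisymm (iSup_le fun p => by simpa using ofReal_slope_le_recession p.2)
    (recession_le_perspective hconv hlsc)

theorem exists_affineMinorant_slope_gt (hconv : ConvexOn ℝ≥0 Set.univ F)
    (hlsc : LowerSemicontinuous F) {r : ℝ≥0∞} (hr : r < recession F) :
    ∃ p ∈ affineMinorants F, r < ENNReal.ofReal p.1 := by
  rw [← perspective_one_zero hconv hlsc] at hr
  obtain ⟨p, hp⟩ := lt_iSup_iff.1 hr
  exact ⟨p.1, p.2, by simpa using hp⟩

end Duality

section Selection

variable {Z : Type*} [MeasurableSpace Z]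

theorem exists_simpleFunc_forall_mem_le {ι β : Type*} [LinearOrder β] [TopologicalSpace β]
    [OrderClosedTopology β] [SecondCountableTopology β] [MeasurableSpace β]
    [OpensMeasurableSpace β] {v : ι → Z → β} (hv : ∀ i, Measurable (v i)) {s : Finset ι}
    (hs : s.Nonempty) : ∃ Q : SimpleFunc Z ι, ∀ z, ∀ i ∈ s, v i z ≤ v (Q z) z := by
  classical
  induction hs using Finset.Nonempty.cons_induction with
  | singleton i => exact ⟨SimpleFunc.const Z i, by simp⟩
  | cons i s _ _ ih =>
    obtain ⟨Q, hQ⟩ := ih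
    have hmeas : MeasurableSet {z | v (Q z) z ≤ v i z} :=
      measurableSet_le (Q.measurable_bind v hv) (hv i)
    refine ⟨SimpleFunc.piecewise _ hmeas (SimpleFunc.const Z i) Q, fun z j hj => ?_⟩
    rw [SimpleFunc.piecewise_apply]
    rcases Finset.mem_cons.1 hj with rfl | hj <;> split_ifs with hz
    exacts [le_rfl, (not_le.1 hz).le, (hQ z j hj).trans hz, hQ z j hj]

theorem exists_simpleFunc_lt_lintegral_iSup {ι : Type*} [TopologicalSpace ι]
    [TopologicalSpace.SeparableSpace ι] {μ : Measure Z} {v : ι → Z → ℝ}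
    (hv : ∀ i, Measurable (v i)) (hcont : ∀ z, Continuous fun i => v i z) (i₀ : ι) {y : ℝ≥0∞}
    (hy : y < ∫⁻ z, ⨆ i, ENNReal.ofReal (v i z) ∂μ) :
    ∃ Q : SimpleFunc Z ι, (∀ z, v i₀ z ≤ v (Q z) z) ∧
      y < ∫⁻ z, ENNReal.ofReal (v (Q z) z) ∂μ := by
  classical
  have : Nonempty ι := ⟨i₀⟩
  set e := TopologicalSpace.denseSeq ι
  have hsup (z : Z) : ⨆ i, ENNReal.ofReal (v i z) =
      ⨆ s : Finset ℕ, ⨆ n ∈ s, ENNReal.ofReal (v (e n) z) := by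
    have hdense := (TopologicalSpace.denseRange_denseSeq ι).ciSup'
      (ENNReal.continuous_ofReal.comp (hcont z))
    rw [← iSup_eq_iSup_finset]
    exact hdense.symm.trans (iSup_range' (fun i => ENNReal.ofReal (v i z)) e)
  simp only [hsup] at hy
  have hmeas (s : Finset ℕ) : Measurable fun z => ⨆ n ∈ s, ENNReal.ofReal (v (e n) z) :=
    Measurable.biSup _ s.countable_toSet fun n _ => (hv (e n)).ennreal_ofReal
  rw [lintegral_iSup_directed (fun s => (hmeas s).aemeasurable)
    (directed_of_isDirected_le fun s t hst z => biSup_mono fun n hn => Finset.mem_of_subset hst hn)]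
    at hy
  obtain ⟨s, hs⟩ := lt_iSup_iff.1 hy
  obtain ⟨Q, hQ⟩ := exists_simpleFunc_forall_mem_le hv (Finset.insert_nonempty i₀ (s.image e))
  refine ⟨Q, fun z => hQ z i₀ (Finset.mem_insert_self _ _),
    hs.trans_le (lintegral_mono fun z => ?_)⟩
  refine iSup₂_le fun n hn => ENNReal.ofReal_le_ofReal (hQ z _ ?_)
  exact Finset.mem_insert_of_mem (Finset.mem_image_of_mem e hn)

end Selection

section EntropyDuality

variable {Z : Type*} [MeasurableSpace Z] {F : ℝ≥0 → ℝ≥0∞}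

theorem exists_relEntropy_eq_lintegral_perspective (hconv : ConvexOn ℝ≥0 Set.univ F)
    (hlsc : LowerSemicontinuous F) (γ μ : Measure Z) [IsFiniteMeasure γ] [IsFiniteMeasure μ] :
    ∃ (ρ : Measure Z) (f g : Z → ℝ≥0), Measurable f ∧ Measurable g ∧
      ρ.withDensity (fun z => f z) = γ ∧ ρ.withDensity (fun z => g z) = μ ∧
      relEntropy F γ μ = ∫⁻ z, perspective F (f z) (g z) ∂ρ := by
  classical
  obtain ⟨S, hS, hπS, hμS⟩ := Measure.mutuallySingular_singularPart γ μ
  set π := γ.singularPart μ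
  set f : Z → ℝ≥0 := S.piecewise (fun z => (γ.rnDeriv μ z).toNNReal) 1
  set g : Z → ℝ≥0 := S.piecewise 1 0
  have hμ : ∀ᵐ z ∂μ, f z = (γ.rnDeriv μ z).toNNReal ∧ g z = 1 := by
    filter_upwards [mem_ae_iff.2 hμS] with z hz
    simp [f, g, hz]
  have hπ : ∀ᵐ z ∂π, f z = 1 ∧ g z = 0 := by
    filter_upwards [measure_eq_zero_iff_ae_notMem.1 hπS] with z hz
    simp [f, g, hz]
  refine ⟨μ + π, f, g, (γ.measurable_rnDeriv μ).ennreal_toNNReal.piecewise hS measurable_one,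
    measurable_one.piecewise hS measurable_zero, ?_, ?_, ?_⟩
  · have hfμ : (fun z => (f z : ℝ≥0∞)) =ᵐ[μ] γ.rnDeriv μ := by
      filter_upwards [hμ, γ.rnDeriv_lt_top μ] with z hz hz'
      rw [hz.1, ENNReal.coe_toNNReal hz'.ne]
    have hfπ : (fun z => (f z : ℝ≥0∞)) =ᵐ[π] 1 := hπ.mono fun z hz => by simp [hz.1]
    rw [withDensity_add_measure, withDensity_congr_ae hfμ, withDensity_congr_ae hfπ,
      withDensity_one, Measure.rnDeriv_add_singularPart]
  · have hgμ : (fun z => (g z : ℝ≥0∞)) =ᵐ[μ] 1 := hμ.mono fun z hz => by simp [hz.2]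
    have hgπ : (fun z => (g z : ℝ≥0∞)) =ᵐ[π] 0 := hπ.mono fun z hz => by simp [hz.2]
    rw [withDensity_add_measure, withDensity_congr_ae hgμ, withDensity_congr_ae hgπ,
      withDensity_one, withDensity_zero, add_zero]
  · rw [lintegral_add_measure, relEntropy, ← lintegral_const]
    congr 1
    · refine lintegral_congr_ae (hμ.mono fun z hz => ?_)
      dsimp only
      rw [hz.1, hz.2, perspective_one_right hconv hlsc]
    · refine lintegral_congr_ae (hπ.mono fun z hz => ?_)
      dsimp only
      rw [hz.1, hz.2, perspective_one_zero hconv hlsc]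

theorem ofReal_integral_le_lintegral_ofReal {ρ : Measure Z} {φ : Z → ℝ} (hφ : Integrable φ ρ) :
    ENNReal.ofReal (∫ z, φ z ∂ρ) ≤ ∫⁻ z, ENNReal.ofReal (φ z) ∂ρ := by
  calc ENNReal.ofReal (∫ z, φ z ∂ρ) ≤ ENNReal.ofReal (∫ z, max (φ z) 0 ∂ρ) :=
        ENNReal.ofReal_le_ofReal (integral_mono hφ hφ.pos_part fun z => le_max_left _ _)
    _ = ∫⁻ z, ENNReal.ofReal (max (φ z) 0) ∂ρ :=
        ofReal_integral_eq_lintegral_ofReal hφ.pos_part (ae_of_all _ fun z => le_max_right _ _)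
    _ = ∫⁻ z, ENNReal.ofReal (φ z) ∂ρ := by simp

theorem integral_add_integral_withDensity {ρ : Measure Z} {f g : Z → ℝ≥0} (hf : Measurable f)
    (hg : Measurable g) {A B : Z → ℝ} (hA : Integrable A (ρ.withDensity fun z => f z))
    (hB : Integrable B (ρ.withDensity fun z => g z)) :
    Integrable (fun z => A z * f z + B z * g z) ρ ∧
      ∫ z, A z ∂(ρ.withDensity fun z => f z) + ∫ z, B z ∂(ρ.withDensity fun z => g z) =
        ∫ z, A z * f z + B z * g z ∂ρ := by
  rw [integrable_withDensity_iff_integrable_smul hf] at hA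
  rw [integrable_withDensity_iff_integrable_smul hg] at hB
  rw [integral_withDensity_eq_integral_smul hf, integral_withDensity_eq_integral_smul hg,
    ← integral_add hA hB]
  simp only [NNReal.smul_def, smul_eq_mul, mul_comm] at *
  exact ⟨hA.add hB, trivial⟩

theorem ofReal_integral_add_integral_le_relEntropy (hconv : ConvexOn ℝ≥0 Set.univ F)
    (hlsc : LowerSemicontinuous F) {γ μ : Measure Z} [IsFiniteMeasure γ] [IsFiniteMeasure μ]
    {A B : Z → ℝ} (hA : Integrable A γ) (hB : Integrable B μ)
    (hAB : ∀ z, (A z, B z) ∈ affineMinorants F) :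
    ENNReal.ofReal (∫ z, A z ∂γ + ∫ z, B z ∂μ) ≤ relEntropy F γ μ := by
  obtain ⟨ρ, f, g, hf, hg, rfl, rfl, heq⟩ :=
    exists_relEntropy_eq_lintegral_perspective hconv hlsc γ μ
  obtain ⟨hint, hsum⟩ := integral_add_integral_withDensity hf hg hA hB
  rw [heq, hsum]
  exact (ofReal_integral_le_lintegral_ofReal hint).trans
    (lintegral_mono fun z => le_iSup_of_le ⟨_, hAB z⟩ le_rfl)

theorem exists_simpleFunc_lt_relEntropy (hconv : ConvexOn ℝ≥0 Set.univ F)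
    (hlsc : LowerSemicontinuous F) {γ μ : Measure Z} [IsFiniteMeasure γ] [IsFiniteMeasure μ]
    {y : ℝ≥0∞} (hy : y < relEntropy F γ μ) :
    ∃ Q : SimpleFunc Z (affineMinorants F),
      y < ENNReal.ofReal (∫ z, (Q z).1.1 ∂γ + ∫ z, (Q z).1.2 ∂μ) := by
  obtain ⟨ρ, f, g, hf, hg, hγ, hμ, heq⟩ :=
    exists_relEntropy_eq_lintegral_perspective hconv hlsc γ μ
  obtain ⟨Q, hQ₀, hQ⟩ := exists_simpleFunc_lt_lintegral_iSup
    (v := fun p : affineMinorants F => fun z => p.1.1 * f z + p.1.2 * g z)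
    (fun p => (hf.coe_nnreal_real.const_mul _).add (hg.coe_nnreal_real.const_mul _))
    (fun z => by fun_prop) ⟨0, zero_mem_affineMinorants⟩ (heq ▸ hy)
  refine ⟨Q, ?_⟩
  have hint (h : affineMinorants F → ℝ) (η : Measure Z) [IsFiniteMeasure η] :
      Integrable (fun z => h (Q z)) η := (Q.map h).integrable_of_isFiniteMeasure
  have hA := hint (fun p => p.1.1) γ
  have hB := hint (fun p => p.1.2) μ
  subst hγ hμ
  obtain ⟨hint, hsum⟩ := integral_add_integral_withDensity hf hg hA hB
  rw [hsum, ofReal_integral_eq_lintegral_ofReal hint (ae_of_all _ fun z => by simpa using hQ₀ z)]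
  exact hQ

end EntropyDuality

section ContinuousApproximation

variable {Z : Type*} [MeasurableSpace Z] [TopologicalSpace Z] [BorelSpace Z]

theorem exists_continuous_seq_tendsto_indicator [NormalSpace Z] (ρ : Measure Z)
    [IsFiniteMeasure ρ] [ρ.WeaklyRegular] {S : Set Z} (hS : MeasurableSet S) :
    ∃ θ : ℕ → Z → ℝ, (∀ k, Continuous (θ k)) ∧ (∀ k z, θ k z ∈ Set.Icc 0 1) ∧
      ∀ᵐ z ∂ρ, Tendsto (fun k => θ k z) atTop (𝓝 (S.indicator 1 z)) := by
  have hmem : MemLp (S.indicator (1 : Z → ℝ)) 1 ρ := (memLp_const 1).indicator hS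
  choose φ hφ hφm using fun k : ℕ =>
    hmem.exists_boundedContinuous_eLpNorm_sub_le ENNReal.one_ne_top
      (ENNReal.inv_ne_zero.2 (ENNReal.natCast_ne_top k))
  have hlim : Tendsto (fun k => eLpNorm (⇑(φ k) - S.indicator (1 : Z → ℝ)) 1 ρ) atTop (𝓝 0) :=
    tendsto_of_tendsto_of_tendsto_of_le_of_le tendsto_const_nhds
      ENNReal.tendsto_inv_nat_nhds_zero (fun _ => zero_le)
      fun k => (eLpNorm_sub_comm _ _ _ _).trans_le (hφ k)
  obtain ⟨n, -, hn⟩ := (tendstoInMeasure_of_tendsto_eLpNorm one_ne_zero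
    (fun k => (hφm k).aestronglyMeasurable) hmem.aestronglyMeasurable hlim).exists_seq_tendsto_ae
  refine ⟨fun k z => max 0 (min 1 (φ (n k) z)),
    fun k => continuous_const.max (continuous_const.min (φ (n k)).continuous),
    fun k z => ⟨le_max_left _ _, max_le zero_le_one (min_le_left _ _)⟩, ?_⟩
  filter_upwards [hn] with z hz
  have hclamp : max 0 (min 1 (S.indicator (1 : Z → ℝ) z)) = S.indicator 1 z := by
    by_cases hzS : z ∈ S <;> simp [hzS]
  rw [← hclamp]
  exact tendsto_const_nhds.max (tendsto_const_nhds.min hz)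

theorem exists_continuous_seq_tendsto_simpleFunc [NormalSpace Z] (ρ : Measure Z)
    [IsFiniteMeasure ρ] [ρ.WeaklyRegular] {E : Type*} [NormedAddCommGroup E] [NormedSpace ℝ E]
    {K : Set E} (hK : Convex ℝ K) [Nonempty K] (Q : SimpleFunc Z K) :
    ∃ (M : ℝ) (R : ℕ → Z → E), (∀ k, Continuous (R k)) ∧
      (∀ k z, R k z ∈ K ∩ Metric.closedBall 0 M) ∧
      ∀ᵐ z ∂ρ, Tendsto (fun k => R k z) atTop (𝓝 (Q z : E)) := by
  classical
  induction Q using SimpleFunc.induction' with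
  | const c =>
    exact ⟨‖(c : E)‖, fun _ _ => c, fun _ => continuous_const, fun _ _ => ⟨c.2, by simp⟩,
      ae_of_all _ fun _ => tendsto_const_nhds⟩
  | @pcw f g S hS ihf ihg =>
    obtain ⟨M, R, hRc, hR, hRf⟩ := ihf
    obtain ⟨M', R', hRc', hR', hRg⟩ := ihg
    obtain ⟨θ, hθc, hθ, hθS⟩ := exists_continuous_seq_tendsto_indicator ρ hS
    refine ⟨max M M', fun k z => θ k z • R k z + (1 - θ k z) • R' k z, fun k => ?_,
      fun k z => ?_, ?_⟩
    · have := hRc k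
      have := hRc' k
      have := hθc k
      fun_prop
    · refine (hK.inter (convex_closedBall 0 (max M M'))) ?_ ?_ (hθ k z).1
        (sub_nonneg.2 (hθ k z).2) (add_sub_cancel _ _)
      exacts [⟨(hR k z).1, Metric.closedBall_subset_closedBall (le_max_left _ _) (hR k z).2⟩,
        ⟨(hR' k z).1, Metric.closedBall_subset_closedBall (le_max_right _ _) (hR' k z).2⟩]
    · filter_upwards [hRf, hRg, hθS] with z hzf hzg hzS
      have hlim := (hzS.smul hzf).add ((hzS.const_sub 1).smul hzg)
      convert hlim using 2
      by_cases hz : z ∈ S <;> simp [SimpleFunc.piecewise_apply, hz]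

end ContinuousApproximation

section EntropySemicontinuity

variable {Z : Type*} [MeasurableSpace Z] [TopologicalSpace Z]
  [TopologicalSpace.PseudoMetrizableSpace Z] [BorelSpace Z] {F : ℝ≥0 → ℝ≥0∞}

theorem exists_continuous_lt_relEntropy (hconv : ConvexOn ℝ≥0 Set.univ F)
    (hlsc : LowerSemicontinuous F) {γ μ : Measure Z} [IsFiniteMeasure γ] [IsFiniteMeasure μ]
    {y : ℝ≥0∞} (hy : y < relEntropy F γ μ) :
    ∃ A B : BoundedContinuousFunction Z ℝ, (∀ z, (A z, B z) ∈ affineMinorants F) ∧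
      y < ENNReal.ofReal (∫ z, A z ∂γ + ∫ z, B z ∂μ) := by
  obtain ⟨Q, hQ⟩ := exists_simpleFunc_lt_relEntropy hconv hlsc hy
  have : Nonempty (affineMinorants F) := ⟨⟨0, zero_mem_affineMinorants⟩⟩
  obtain ⟨M, R, hRc, hR, hRQ⟩ :=
    exists_continuous_seq_tendsto_simpleFunc (γ + μ) convex_affineMinorants Q
  rw [ae_add_measure_iff] at hRQ
  have hnorm (k : ℕ) (z : Z) : ‖R k z‖ ≤ M := mem_closedBall_zero_iff.1 (hR k z).2
  have hlim {η : Measure Z} [IsFiniteMeasure η] (L : ℝ × ℝ → ℝ) (hL : Continuous L)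
      (hLn : ∀ p, ‖L p‖ ≤ ‖p‖) (hη : ∀ᵐ z ∂η, Tendsto (fun k => R k z) atTop (𝓝 (Q z : ℝ × ℝ))) :
      Tendsto (fun k => ∫ z, L (R k z) ∂η) atTop (𝓝 (∫ z, L (Q z) ∂η)) :=
    tendsto_integral_of_dominated_convergence (fun _ => M)
      (fun k => (hL.comp (hRc k)).measurable.aestronglyMeasurable) (integrable_const M)
      (fun k => ae_of_all _ fun z => (hLn _).trans (hnorm k z))
      (hη.mono fun z hz => (hL.tendsto _).comp hz)
  have hsum := (hlim Prod.fst continuous_fst norm_fst_le hRQ.1).add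
    (hlim Prod.snd continuous_snd norm_snd_le hRQ.2)
  obtain ⟨k, hk⟩ := ((ENNReal.tendsto_ofReal hsum).eventually_const_lt hQ).exists
  exact ⟨.ofNormedAddCommGroup _ (hRc k).fst M fun z => (norm_fst_le _).trans (hnorm k z),
    .ofNormedAddCommGroup _ (hRc k).snd M fun z => (norm_snd_le _).trans (hnorm k z),
    fun z => (hR k z).1, hk⟩

theorem lowerSemicontinuous_relEntropy (hconv : ConvexOn ℝ≥0 Set.univ F)
    (hlsc : LowerSemicontinuous F) (μ : Measure Z) [IsFiniteMeasure μ] :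
    LowerSemicontinuous fun γ : FiniteMeasure Z => relEntropy F (γ : Measure Z) μ := by
  intro γ y hy
  obtain ⟨A, B, hAB, hlt⟩ := exists_continuous_lt_relEntropy hconv hlsc hy
  have hcont : Continuous fun η : FiniteMeasure Z =>
      ENNReal.ofReal (∫ z, A z ∂(η : Measure Z) + ∫ z, B z ∂μ) :=
    ENNReal.continuous_ofReal.comp
      ((FiniteMeasure.continuous_integral_boundedContinuousFunction A).add continuous_const)
  filter_upwards [(hcont.tendsto γ).eventually_const_lt hlt] with η hη
  exact hη.trans_le (ofReal_integral_add_integral_le_relEntropy hconv hlsc (A.integrable _)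
    (B.integrable _) hAB)

end EntropySemicontinuity

section LowerSemicontinuousIntegrand

variable {Z : Type*}

/-- The infimal convolution of `min g n` with `n` times the distance: these `n`-Lipschitz functions
increase to `g` when `g` is lower semicontinuous. -/
noncomputable def infConvDist [PseudoEMetricSpace Z] (g : Z → ℝ≥0∞) (n : ℕ) (x : Z) : ℝ≥0∞ :=
  ⨅ y, (min (g y) n + n * edist x y)

section PseudoEMetric

variable [PseudoEMetricSpace Z] {g : Z → ℝ≥0∞}

theorem infConvDist_le_min (n : ℕ) (x : Z) : infConvDist g n x ≤ min (g x) n :=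
  (iInf_le _ x).trans (by simp)

theorem infConvDist_mono : Monotone (infConvDist g) := fun m n hmn x => by
  refine iInf_mono fun y => ?_
  have h : (m : ℝ≥0∞) ≤ n := mod_cast hmn
  gcongr

theorem infConvDist_le_add (n : ℕ) (x x' : Z) :
    infConvDist g n x ≤ infConvDist g n x' + n * edist x x' := by
  simp only [infConvDist, ENNReal.iInf_add]
  refine iInf_mono fun y => ?_
  calc min (g y) n + n * edist x y ≤ min (g y) n + n * (edist x x' + edist x' y) := by
        gcongr
        exact edist_triangle _ _ _
    _ = min (g y) n + n * edist x' y + n * edist x x' := by ring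

theorem continuous_infConvDist (n : ℕ) : Continuous (infConvDist g n) :=
  continuous_of_le_add_edist n (ENNReal.natCast_ne_top n) (infConvDist_le_add n)

theorem iSup_infConvDist (hg : LowerSemicontinuous g) (x : Z) : ⨆ n, infConvDist g n x = g x := by
  refine le_antisymm (iSup_le fun n => (infConvDist_le_min n x).trans (min_le_left _ _))
    (le_of_forall_lt fun y hy => ?_)
  obtain ⟨r, hyr, hr⟩ := exists_between hy
  obtain ⟨δ, hδ, hball⟩ := EMetric.mem_nhds_iff.1 (hg x r hr)
  obtain ⟨k, hk⟩ := ENNReal.exists_nat_mul_gt hδ.ne' hr.ne_top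
  obtain ⟨m, hm⟩ := ENNReal.exists_nat_gt hr.ne_top
  suffices h : r ≤ infConvDist g (max m k) x from hyr.trans_le (le_iSup_of_le _ h)
  refine le_iInf fun z => ?_
  rcases lt_or_ge (edist z x) δ with hz | hz
  · refine le_add_right (le_min (hball hz).le (hm.le.trans ?_))
    exact mod_cast le_max_left m k
  · refine le_add_left (hk.le.trans ?_)
    rw [edist_comm]
    gcongr
    exact le_max_right m k

end PseudoEMetric

theorem lowerSemicontinuous_lintegral [TopologicalSpace Z]
    [TopologicalSpace.PseudoMetrizableSpace Z] [MeasurableSpace Z] [OpensMeasurableSpace Z]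
    {g : Z → ℝ≥0∞} (hg : LowerSemicontinuous g) :
    LowerSemicontinuous fun γ : FiniteMeasure Z => ∫⁻ z, g z ∂(γ : Measure Z) := by
  let := TopologicalSpace.pseudoMetrizableSpacePseudoMetric Z
  have hsup (γ : FiniteMeasure Z) :
      ∫⁻ z, g z ∂(γ : Measure Z) = ⨆ n, ∫⁻ z, infConvDist g n z ∂(γ : Measure Z) := by
    rw [← lintegral_iSup (fun n => (continuous_infConvDist n).measurable) infConvDist_mono]
    exact lintegral_congr fun z => (iSup_infConvDist hg z).symm
  simp only [hsup]
  refine lowerSemicontinuous_iSup fun n => Continuous.lowerSemicontinuous ?_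
  have hle (z : Z) : infConvDist g n z ≤ n := (infConvDist_le_min n z).trans (min_le_right _ _)
  have htop (z : Z) : infConvDist g n z ≠ ⊤ :=
    ne_top_of_le_ne_top (ENNReal.natCast_ne_top n) (hle z)
  let A : BoundedContinuousFunction Z ℝ≥0 := BoundedContinuousFunction.mkOfBound
    ⟨fun z => (infConvDist g n z).toNNReal,
      ENNReal.continuousOn_toNNReal.comp_continuous (continuous_infConvDist n) htop⟩ n
    fun x y => by
      have h (z : Z) : (infConvDist g n z).toReal ∈ Set.Icc 0 (n : ℝ) :=
        ⟨ENNReal.toReal_nonneg, ENNReal.toReal_mono (ENNReal.natCast_ne_top n) (hle z)⟩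
      exact (Real.dist_le_of_mem_Icc (h x) (h y)).trans_eq (sub_zero _)
  have hA (z : Z) : (A z : ℝ≥0∞) = infConvDist g n z := ENNReal.coe_toNNReal (htop z)
  simpa only [hA] using FiniteMeasure.continuous_lintegral_boundedContinuousFunction A

end LowerSemicontinuousIntegrand

section LinearCost

theorem ofReal_add_ofReal_neg_eq {x b : ℝ} (h : b ≤ x) :
    ENNReal.ofReal x + ENNReal.ofReal (-b)
      = ENNReal.ofReal (x - b) + ENNReal.ofReal (-x) + ENNReal.ofReal b := by
  simp only [ENNReal.ofReal, ← ENNReal.coe_add, ENNReal.coe_inj]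
  apply NNReal.coe_injective
  simp only [NNReal.coe_add, Real.coe_toNNReal']
  grind

theorem toENNReal_add_ofReal_neg_eq {x : EReal} {b : ℝ} (h : (b : EReal) ≤ x) :
    x.toENNReal + ENNReal.ofReal (-b)
      = (x - b).toENNReal + (-x).toENNReal + ENNReal.ofReal b := by
  induction x with
  | bot => simp at h
  | top => simp
  | coe x => exact_mod_cast ofReal_add_ofReal_neg_eq (EReal.coe_le_coe_iff.1 h)

theorem coe_sub_coe_eq_of_add_ofReal_eq {P N G : ℝ≥0∞} {r : ℝ} (hN : N ≠ ⊤)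
    (h : P + ENNReal.ofReal (-r) = G + N + ENNReal.ofReal r) :
    (P : EReal) - N = G + (r : EReal) := by
  lift N to ℝ≥0 using hN
  rcases eq_or_ne G ⊤ with rfl | hG
  · have hP : P = ⊤ := by
      by_contra hP
      simp [hP] at h
    rw [hP, EReal.coe_ennreal_top, EReal.top_add_coe]
    rfl
  have hP : P ≠ ⊤ := by
    rintro rfl
    simp [ENNReal.add_eq_top, hG, eq_comm] at h
  lift G to ℝ≥0 using hG
  lift P to ℝ≥0 using hP
  have h' := congrArg ENNReal.toReal h
  simp only [ENNReal.toReal_add, ENNReal.add_ne_top, ne_eq, ENNReal.coe_ne_top,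
    ENNReal.ofReal_ne_top, not_false_eq_true, and_self, ENNReal.coe_toReal,
    ENNReal.toReal_ofReal'] at h'
  have hreal : (P : ℝ) - N = G + r := by grind
  simp only [EReal.coe_nnreal_eq_coe_real]
  exact_mod_cast hreal

variable {Z : Type*} {c : Z → EReal} {b : ℝ}

theorem linearCost_eq [MeasurableSpace Z] (hc : Measurable c) (hb : ∀ z, (b : EReal) ≤ c z)
    (γ : Measure Z) [IsFiniteMeasure γ] :
    linearCost c γ = ((∫⁻ z, (c z - b).toENNReal ∂γ : ℝ≥0∞) : EReal)
      + ((b * γ.real Set.univ : ℝ) : EReal) := by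
  refine coe_sub_coe_eq_of_add_ofReal_eq (ne_top_of_le_ne_top ?_ (lintegral_mono fun z =>
    EReal.toENNReal_le_toENNReal (EReal.neg_le_neg_iff.2 (hb z)))) ?_
  · rw [lintegral_const, ← EReal.coe_neg, EReal.real_coe_toENNReal]
    exact ENNReal.mul_ne_top ENNReal.ofReal_ne_top (measure_ne_top γ _)
  · have h := lintegral_congr (μ := γ) fun z => toENNReal_add_ofReal_neg_eq (hb z)
    have hneg : Measurable fun z => (-c z).toENNReal := hc.neg.ereal_toENNReal
    rwa [lintegral_add_right _ measurable_const, lintegral_add_right _ measurable_const,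
      lintegral_add_right _ hneg, lintegral_const, lintegral_const, ← ofReal_measureReal,
      ← ENNReal.ofReal_mul' measureReal_nonneg, ← ENNReal.ofReal_mul' measureReal_nonneg,
      neg_mul] at h

theorem lowerSemicontinuous_toENNReal_sub [TopologicalSpace Z] (hc : LowerSemicontinuous c)
    (b : ℝ) : LowerSemicontinuous fun z => (c z - b).toENNReal := by
  have hcont : Continuous fun x : EReal => (x - b).toENNReal := by
    refine Continuous.ereal_toENNReal (continuous_iff_continuousAt.2 fun x => ?_)
    simp only [sub_eq_add_neg, ← EReal.coe_neg]
    exact (EReal.continuousAt_add (p := (x, ((-b : ℝ) : EReal))) (Or.inr (EReal.coe_ne_bot _))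
      (Or.inr (EReal.coe_ne_top _))).comp (f := fun x : EReal => (x, ((-b : ℝ) : EReal)))
      (by fun_prop)
  exact hcont.comp_lowerSemicontinuous hc fun x y hxy =>
    EReal.toENNReal_le_toENNReal (EReal.sub_le_sub hxy le_rfl)

end LinearCost

section Tightness

variable {Z : Type*} [MeasurableSpace Z] [TopologicalSpace Z]

theorem isTightMeasureSet_setOf_lintegral_le {g : Z → ℝ≥0∞} (hg : Measurable g)
    (hcpt : ∀ k : ℝ≥0, IsCompact {z | g z ≤ k}) {C : ℝ≥0∞} (hC : C ≠ ⊤) :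
    IsTightMeasureSet {γ : Measure Z | ∫⁻ z, g z ∂γ ≤ C} := by
  rw [isTightMeasureSet_iff_exists_isCompact_measure_compl_le]
  intro δ hδ
  obtain ⟨n, hn⟩ := ENNReal.exists_nat_mul_gt hδ.ne' hC
  refine ⟨_, hcpt n, fun γ hγ => le_of_not_gt fun hlt => hn.not_ge ?_⟩
  calc n * δ ≤ n * γ {z | (n : ℝ≥0∞) ≤ g z} := by
        gcongr
        exact hlt.le.trans (measure_mono fun z (hz : ¬ g z ≤ (n : ℝ≥0∞)) => (not_le.1 hz).le)
    _ ≤ ∫⁻ z, g z ∂γ := mul_meas_ge_le_lintegral hg _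
    _ ≤ C := hγ

end Tightness

section EntropyTightness

variable {Z : Type*} [MeasurableSpace Z] {F : ℝ≥0 → ℝ≥0∞}

theorem ofReal_measureReal_le_relEntropy (hconv : ConvexOn ℝ≥0 Set.univ F)
    (hlsc : LowerSemicontinuous F) {p : ℝ × ℝ} (hp : p ∈ affineMinorants F) (γ μ : Measure Z)
    [IsFiniteMeasure γ] [IsFiniteMeasure μ] {E : Set Z} (hE : MeasurableSet E) :
    ENNReal.ofReal (p.1 * γ.real E + p.2 * μ.real E) ≤ relEntropy F γ μ := by
  have hint (a : ℝ) (η : Measure Z) [IsFiniteMeasure η] :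
      Integrable (E.indicator fun _ => a) η := (integrable_const a).indicator hE
  have h := ofReal_integral_add_integral_le_relEntropy hconv hlsc (hint p.1 γ) (hint p.2 μ)
    fun z => by
      by_cases hz : z ∈ E
      · simpa [hz] using hp
      · rw [Set.indicator_of_notMem hz, Set.indicator_of_notMem hz]
        exact zero_mem_affineMinorants
  simpa [integral_indicator hE, mul_comm] using h

theorem isTightMeasureSet_setOf_relEntropy_le [TopologicalSpace Z] [T2Space Z]
    [OpensMeasurableSpace Z] (hconv : ConvexOn ℝ≥0 Set.univ F)
    (hlsc : LowerSemicontinuous F) (hrec : recession F = ⊤)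
    {ν : Measure Z} [IsFiniteMeasure ν] (hν : IsTightMeasureSet {ν}) {C : ℝ≥0∞} (hC : C ≠ ⊤) :
    IsTightMeasureSet {γ : Measure Z | IsFiniteMeasure γ ∧ relEntropy F γ ν ≤ C} := by
  lift C to ℝ≥0 using hC
  rw [isTightMeasureSet_iff_exists_isCompact_measure_compl_le] at hν ⊢
  intro δ hδ
  obtain ⟨d, hd, hdδ⟩ := ENNReal.lt_iff_exists_nnreal_btwn.1 hδ
  have hd' : (0 : ℝ) < d := mod_cast hd
  obtain ⟨p, hp, hslope⟩ := exists_affineMinorant_slope_gt hconv hlsc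
    (r := ENNReal.ofReal ((C + 1) / d)) (by simp [hrec])
  rw [ENNReal.ofReal_lt_ofReal_iff_of_nonneg (by positivity), div_lt_iff₀ hd'] at hslope
  obtain ⟨K, hK, hKν⟩ := hν (ENNReal.ofReal (1 / (|p.2| + 1)))
    (ENNReal.ofReal_pos.2 (by positivity))
  have hνK : -1 ≤ p.2 * ν.real Kᶜ := by
    have h : ν.real Kᶜ * (|p.2| + 1) ≤ 1 := (le_div_iff₀ (by positivity)).1
      (ENNReal.toReal_le_of_le_ofReal (by positivity) (hKν ν rfl))
    nlinarith [neg_abs_le p.2, measureReal_nonneg (μ := ν) (s := Kᶜ)]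
  refine ⟨K, hK, fun γ ⟨_, hγ⟩ => le_of_not_gt fun hlt => ?_⟩
  have hγK : d ≤ γ.real Kᶜ := by
    simpa [measureReal_def] using ENNReal.toReal_mono (measure_ne_top γ Kᶜ) (hdδ.trans hlt).le
  have hmass : p.1 * γ.real Kᶜ + p.2 * ν.real Kᶜ ≤ C := by
    simpa using (ENNReal.ofReal_le_iff_le_toReal ENNReal.coe_ne_top).1
      ((ofReal_measureReal_le_relEntropy hconv hlsc hp γ ν hK.measurableSet.compl).trans hγ)
  have hp0 : 0 < p.1 := pos_of_mul_pos_left (lt_trans (by positivity) hslope) hd'.le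
  linarith [mul_le_mul_of_nonneg_left hγK hp0.le]

end EntropyTightness

section Coercivity

theorem exists_affineMinorant_mul_add_pos {F : ℝ≥0 → ℝ≥0∞} (hconv : ConvexOn ℝ≥0 Set.univ F)
    (hlsc : LowerSemicontinuous F) {k b : ℝ} (hk : 0 < k)
    (h : 0 < (k : EReal) * (recession F : EReal) + b) :
    ∃ p ∈ affineMinorants F, 0 < k * p.1 + b := by
  rcases lt_or_ge 0 b with hb | hb
  · exact ⟨0, zero_mem_affineMinorants, by simpa using hb⟩
  have hbk : 0 ≤ -b / k := div_nonneg (neg_nonneg.2 hb) hk.le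
  have hlt : ENNReal.ofReal (-b / k) < recession F := by
    by_contra! hle
    refine h.not_ge ?_
    have hle' : (recession F : EReal) ≤ ((-b / k : ℝ) : EReal) := by
      simpa [EReal.coe_ennreal_ofReal, hbk] using EReal.coe_ennreal_le_coe_ennreal_iff.2 hle
    calc (k : EReal) * (recession F : EReal) + b ≤ (k : EReal) * ((-b / k : ℝ) : EReal) + b := by
          gcongr
      _ = ((k * (-b / k) + b : ℝ) : EReal) := by push_cast; rfl
      _ = 0 := by rw [mul_div_cancel₀ _ hk.ne', neg_add_cancel, EReal.coe_zero]
  obtain ⟨p, hp, hslope⟩ := exists_affineMinorant_slope_gt hconv hlsc hlt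
  rw [ENNReal.ofReal_lt_ofReal_iff_of_nonneg hbk, div_lt_iff₀ hk] at hslope
  exact ⟨p, hp, by linarith⟩

theorem exists_lower_bound_add_pos {ι : Type*} {c : ι → EReal} {r : EReal} (hr : 0 ≤ r)
    (hc : ∃ b : ℝ, ∀ i, (b : EReal) ≤ c i) (h : r = ⊤ ∨ 0 < r + ⨅ i, c i) :
    ∃ b : ℝ, (∀ i, (b : EReal) ≤ c i) ∧ 0 < r + b := by
  obtain ⟨b, hb⟩ := hc
  rcases h with rfl | h
  · exact ⟨b, hb, by simp⟩
  have hbc : (b : EReal) ≤ ⨅ i, c i := le_iInf hb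
  have hcI (i) : ⨅ j, c j ≤ c i := iInf_le c i
  generalize ⨅ i, c i = I at h hbc hcI
  induction I with
  | bot => simp at hbc
  | top =>
    refine ⟨1, fun i => le_top.trans (hcI i), ?_⟩
    exact (EReal.coe_pos.2 one_pos).trans_le (le_add_of_nonneg_left hr)
  | coe b' => exact ⟨b', hcI, h⟩

end Coercivity

section RegularisedFunctional

variable {X : Type*} [MeasurableSpace X] {F : ℝ≥0 → ℝ≥0∞} {c : X × X → EReal} {ε b : ℝ}
  {μ₀ μ₁ : FiniteMeasure X} {ν γ : FiniteMeasure (X × X)}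

/-- The regularised functional with the cost `c` replaced by the positive part of `c - b`. For a
lower bound `b` of `c` it differs from the regularised functional by `b` times the mass of `γ`, and
all its terms are nonnegative. -/
noncomputable def shiftedPrimalReg (F : ℝ≥0 → ℝ≥0∞) (c : X × X → EReal) (ε b : ℝ)
    (μ₀ μ₁ : FiniteMeasure X) (ν γ : FiniteMeasure (X × X)) : ℝ≥0∞ :=
  relEntropy F (γ : Measure (X × X)).fst μ₀ + relEntropy F (γ : Measure (X × X)).snd μ₁
    + ∫⁻ z, (c z - b).toENNReal ∂(γ : Measure (X × X))
    + ENNReal.ofReal ε * relEntropy F (γ : Measure (X × X)) ν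

theorem primalReg_eq (hc : Measurable c) (hε : 0 ≤ ε) (hb : ∀ z, (b : EReal) ≤ c z) :
    primalReg F c ε μ₀ μ₁ ν γ =
      (shiftedPrimalReg F c ε b μ₀ μ₁ ν γ : EReal) + ((b * γ.mass : ℝ) : EReal) := by
  have hε' : (ε : EReal) = ((ENNReal.ofReal ε : ℝ≥0∞) : EReal) := by
    rw [EReal.coe_ennreal_ofReal, max_eq_left hε]
  rw [primalReg, primal, shiftedPrimalReg, linearCost_eq hc hb, hε']
  simp only [EReal.coe_ennreal_add, EReal.coe_ennreal_mul]
  rw [← add_assoc, add_right_comm]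
  rfl

theorem lowerSemicontinuous_shiftedPrimalReg [TopologicalSpace X]
    [TopologicalSpace.PseudoMetrizableSpace X] [SecondCountableTopology X] [BorelSpace X]
    (hconv : ConvexOn ℝ≥0 Set.univ F) (hlsc : LowerSemicontinuous F)
    (hc : LowerSemicontinuous c) :
    LowerSemicontinuous (shiftedPrimalReg F c ε b μ₀ μ₁ ν) := by
  have hfst := (lowerSemicontinuous_relEntropy hconv hlsc (μ₀ : Measure X)).comp
    (FiniteMeasure.continuous_map (continuous_fst (X := X) (Y := X)))
  have hsnd := (lowerSemicontinuous_relEntropy hconv hlsc (μ₁ : Measure X)).comp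
    (FiniteMeasure.continuous_map (continuous_snd (X := X) (Y := X)))
  have hcost := lowerSemicontinuous_lintegral (lowerSemicontinuous_toENNReal_sub hc b)
  have hreg := (ENNReal.continuous_const_mul
    (ENNReal.ofReal_ne_top (r := ε))).comp_lowerSemicontinuous
      (lowerSemicontinuous_relEntropy hconv hlsc (ν : Measure (X × X)))
      fun x y hxy => mul_le_mul_right hxy _
  exact ((hfst.add hsnd).add hcost).add hreg

theorem lowerSemicontinuous_primalReg [TopologicalSpace X]
    [TopologicalSpace.PseudoMetrizableSpace X] [SecondCountableTopology X] [BorelSpace X]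
    (hconv : ConvexOn ℝ≥0 Set.univ F) (hlsc : LowerSemicontinuous F)
    (hc : LowerSemicontinuous c) (hε : 0 ≤ ε) (hb : ∀ z, (b : EReal) ≤ c z) :
    LowerSemicontinuous (primalReg F c ε μ₀ μ₁ ν) := by
  have hmass : Continuous fun γ : FiniteMeasure (X × X) => ((b * γ.mass : ℝ) : EReal) :=
    continuous_coe_real_ereal.comp (continuous_const.mul
      (NNReal.continuous_coe.comp FiniteMeasure.continuous_mass))
  have hshift := continuous_coe_ennreal_ereal.comp_lowerSemicontinuous
    (lowerSemicontinuous_shiftedPrimalReg (ε := ε) (b := b) (μ₀ := μ₀) (μ₁ := μ₁) (ν := ν)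
      hconv hlsc hc) EReal.coe_ennreal_strictMono.monotone
  rw [show primalReg F c ε μ₀ μ₁ ν = _ from funext fun γ => primalReg_eq hc.measurable hε hb]
  exact hshift.add' hmass.lowerSemicontinuous fun γ =>
    EReal.continuousAt_add (Or.inr (EReal.coe_ne_bot _)) (Or.inr (EReal.coe_ne_top _))

theorem ofReal_mass_le_shiftedPrimalReg (hconv : ConvexOn ℝ≥0 Set.univ F)
    (hlsc : LowerSemicontinuous F) (hε : 0 ≤ ε) {p : ℝ × ℝ} (hp : p ∈ affineMinorants F) :
    ENNReal.ofReal ((2 + ε) * p.1 * γ.mass + p.2 * (μ₀.mass + μ₁.mass + ε * ν.mass)) ≤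
      shiftedPrimalReg F c ε b μ₀ μ₁ ν γ := by
  have hentropy {Z : Type _} [MeasurableSpace Z] (η μ : Measure Z) [IsFiniteMeasure η]
      [IsFiniteMeasure μ] := ofReal_measureReal_le_relEntropy hconv hlsc hp η μ MeasurableSet.univ
  have hfst : (γ : Measure (X × X)).fst.real Set.univ = γ.mass := by
    rw [measureReal_def, Measure.fst_univ]; rfl
  have hsnd : (γ : Measure (X × X)).snd.real Set.univ = γ.mass := by
    rw [measureReal_def, Measure.snd_univ]; rfl
  calc ENNReal.ofReal ((2 + ε) * p.1 * γ.mass + p.2 * (μ₀.mass + μ₁.mass + ε * ν.mass))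
      = ENNReal.ofReal ((p.1 * γ.mass + p.2 * μ₀.mass) + (p.1 * γ.mass + p.2 * μ₁.mass)
          + ε * (p.1 * γ.mass + p.2 * ν.mass)) := by ring_nf
    _ ≤ ENNReal.ofReal (p.1 * γ.mass + p.2 * μ₀.mass)
          + ENNReal.ofReal (p.1 * γ.mass + p.2 * μ₁.mass)
          + ENNReal.ofReal ε * ENNReal.ofReal (p.1 * γ.mass + p.2 * ν.mass) := by
        rw [← ENNReal.ofReal_mul hε]
        exact ENNReal.ofReal_add_le.trans (add_le_add_left ENNReal.ofReal_add_le _)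
    _ ≤ shiftedPrimalReg F c ε b μ₀ μ₁ ν γ := by
        refine add_le_add (le_add_right (add_le_add ?_ ?_)) (mul_le_mul_right ?_ _)
        · exact hfst ▸ hentropy (γ : Measure (X × X)).fst μ₀
        · exact hsnd ▸ hentropy (γ : Measure (X × X)).snd μ₁
        · exact hentropy (γ : Measure (X × X)) ν

theorem coe_mass_le_primalReg (hconv : ConvexOn ℝ≥0 Set.univ F)
    (hlsc : LowerSemicontinuous F) (hc : Measurable c) (hε : 0 ≤ ε)
    (hb : ∀ z, (b : EReal) ≤ c z) {p : ℝ × ℝ} (hp : p ∈ affineMinorants F) :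
    ((((2 + ε) * p.1 + b) * γ.mass + p.2 * (μ₀.mass + μ₁.mass + ε * ν.mass) : ℝ) : EReal) ≤
      primalReg F c ε μ₀ μ₁ ν γ := by
  have h := EReal.coe_ennreal_le_coe_ennreal_iff.2
    (ofReal_mass_le_shiftedPrimalReg (c := c) (b := b) (μ₀ := μ₀) (μ₁ := μ₁) (ν := ν) (γ := γ)
      hconv hlsc hε hp)
  rw [EReal.coe_ennreal_ofReal] at h
  rw [primalReg_eq hc hε hb]
  refine le_trans ?_ (add_le_add_left ((EReal.coe_le_coe_iff.2 (le_max_left _ _)).trans h) _)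
  rw [← EReal.coe_add, EReal.coe_le_coe_iff]
  linarith

theorem mass_le_of_primalReg_le (hconv : ConvexOn ℝ≥0 Set.univ F)
    (hlsc : LowerSemicontinuous F) (hc : Measurable c) (hε : 0 ≤ ε)
    (hb : ∀ z, (b : EReal) ≤ c z) {p : ℝ × ℝ} (hp : p ∈ affineMinorants F)
    (hpos : 0 < (2 + ε) * p.1 + b) {T : ℝ} (hT : primalReg F c ε μ₀ μ₁ ν γ ≤ T) :
    γ.mass ≤
      (T - p.2 * (μ₀.mass + μ₁.mass + ε * ν.mass)) / ((2 + ε) * p.1 + b) := by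
  rw [le_div_iff₀ hpos]
  linarith [EReal.coe_le_coe_iff.1 ((coe_mass_le_primalReg hconv hlsc hc hε hb hp).trans hT)]

theorem shiftedPrimalReg_le_of_primalReg_le (hc : Measurable c) (hε : 0 ≤ ε)
    (hb : ∀ z, (b : EReal) ≤ c z) {T M : ℝ} (hM : γ.mass ≤ M)
    (hT : primalReg F c ε μ₀ μ₁ ν γ ≤ T) :
    shiftedPrimalReg F c ε b μ₀ μ₁ ν γ ≤ ENNReal.ofReal (T + |b| * M) := by
  rw [primalReg_eq hc hε hb] at hT
  have h := (EReal.le_sub_iff_add_le (Or.inl (EReal.coe_ne_bot _))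
    (Or.inl (EReal.coe_ne_top _))).2 hT
  rw [← EReal.coe_sub] at h
  rw [← EReal.real_coe_toENNReal, ← EReal.toENNReal_coe (x := shiftedPrimalReg F c ε b μ₀ μ₁ ν γ)]
  refine EReal.toENNReal_le_toENNReal (h.trans (EReal.coe_le_coe_iff.2 ?_))
  nlinarith [neg_abs_le b, abs_nonneg b, γ.mass.coe_nonneg]

end RegularisedFunctional

section DirectMethod

variable {Z : Type*} [MeasurableSpace Z] [TopologicalSpace Z] [T4Space Z] [BorelSpace Z]

theorem exists_isCompact_superset_of_isTightMeasureSet {S : Set (FiniteMeasure Z)} {M : ℝ≥0}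
    (hM : ∀ γ ∈ S, γ.mass ≤ M)
    (hS : IsTightMeasureSet ((fun γ : FiniteMeasure Z => (γ : Measure Z)) '' S)) :
    ∃ K, IsCompact K ∧ S ⊆ K := by
  rw [isTightMeasureSet_iff_exists_isCompact_measure_compl_le] at hS
  choose K hK hKS using fun n : ℕ =>
    hS ((1 / ((n : ℝ≥0) + 1) : ℝ≥0) : ℝ≥0∞) (ENNReal.coe_pos.2 (by positivity))
  refine ⟨_, isCompact_setOfPred_finiteMeasure_mass_le_compl_isCompact_le M
    (tendsto_one_div_add_atTop_nhds_zero_nat (𝕜 := ℝ≥0)) hK (Or.inl inferInstance),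
    fun γ hγ => ⟨hM γ hγ, fun n => ?_⟩⟩
  rw [← ENNReal.coe_le_coe, FiniteMeasure.ennreal_coeFn_eq_coeFn_toMeasure]
  exact hKS n γ ⟨γ, hγ, rfl⟩

theorem exists_eq_iInf_of_isTightMeasureSet {J : FiniteMeasure Z → EReal}
    (hJ : LowerSemicontinuous J)
    (hM : ∀ T : ℝ, ∃ M : ℝ≥0, ∀ γ, J γ ≤ T → γ.mass ≤ M)
    (htight : ∀ T : ℝ,
      IsTightMeasureSet ((fun γ : FiniteMeasure Z => (γ : Measure Z)) '' {γ | J γ ≤ T})) :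
    ∃ γ, J γ = ⨅ η, J η := by
  by_cases htop : ∀ γ, J γ = ⊤
  · exact ⟨0, by simp [htop]⟩
  push Not at htop
  obtain ⟨γ₀, hγ₀⟩ := htop
  obtain ⟨T, hT, -⟩ := EReal.lt_iff_exists_real_btwn.1 hγ₀.lt_top
  obtain ⟨M, hM⟩ := hM T
  obtain ⟨K, hK, hTK⟩ := exists_isCompact_superset_of_isTightMeasureSet hM (htight T)
  obtain ⟨γ, -, hmin⟩ := (hJ.lowerSemicontinuousOn K).exists_isMinOn ⟨γ₀, hTK hT.le⟩ hK
  refine ⟨γ, le_antisymm (le_iInf fun η => ?_) (iInf_le J γ)⟩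
  rcases le_or_gt (J η) T with h | h
  · exact hmin (hTK h)
  · exact (hmin (hTK hT.le)).trans (hT.trans h).le

end DirectMethod

section TightSublevels

variable {X : Type*} [MeasurableSpace X] [TopologicalSpace X] {F : ℝ≥0 → ℝ≥0∞}
  {c : X × X → EReal} {ε b : ℝ} {μ₀ μ₁ : FiniteMeasure X} {ν : FiniteMeasure (X × X)}

theorem isTightMeasureSet_shiftedPrimalReg_le_of_recession_eq_top [T2Space X]
    [OpensMeasurableSpace X] (hconv : ConvexOn ℝ≥0 Set.univ F) (hlsc : LowerSemicontinuous F)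
    (hrec : recession F = ⊤) (hμ₀ : IsTightMeasureSet {(μ₀ : Measure X)})
    (hμ₁ : IsTightMeasureSet {(μ₁ : Measure X)}) {C : ℝ≥0∞} (hC : C ≠ ⊤) :
    IsTightMeasureSet ((fun γ : FiniteMeasure (X × X) => (γ : Measure (X × X))) ''
      {γ | shiftedPrimalReg F c ε b μ₀ μ₁ ν γ ≤ C}) := by
  refine .prodMk
    ((isTightMeasureSet_setOf_relEntropy_le hconv hlsc hrec hμ₀ hC).subset ?_)
    ((isTightMeasureSet_setOf_relEntropy_le hconv hlsc hrec hμ₁ hC).subset ?_)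
  all_goals
    rintro _ ⟨_, ⟨γ, hγ, rfl⟩, rfl⟩
    refine ⟨inferInstance, le_trans ?_ hγ⟩
  · exact le_add_right (le_add_right le_self_add)
  · exact le_add_right (le_add_right le_add_self)

theorem toENNReal_sub_coe_le_coe_iff {x : EReal} {k : ℝ≥0} :
    (x - b).toENNReal ≤ k ↔ x ≤ ((b + k : ℝ) : EReal) := by
  induction x with
  | bot => simp
  | top => simp [-EReal.coe_add]
  | coe x =>
    rw [← EReal.coe_sub, EReal.real_coe_toENNReal, EReal.coe_le_coe_iff,
      ENNReal.ofReal_le_iff_le_toReal ENNReal.coe_ne_top, ENNReal.coe_toReal, sub_le_iff_le_add']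

theorem isTightMeasureSet_shiftedPrimalReg_le_of_isCompact (hc : Measurable c)
    (hcpt : ∀ k : ℝ, IsCompact {p | c p ≤ k}) {C : ℝ≥0∞} (hC : C ≠ ⊤) :
    IsTightMeasureSet ((fun γ : FiniteMeasure (X × X) => (γ : Measure (X × X))) ''
      {γ | shiftedPrimalReg F c ε b μ₀ μ₁ ν γ ≤ C}) := by
  have hmeas : Measurable fun p => (c p - b).toENNReal :=
    (hc.sub measurable_const).ereal_toENNReal
  refine (isTightMeasureSet_setOf_lintegral_le hmeas (fun k => ?_) hC).subset ?_
  · simpa only [toENNReal_sub_coe_le_coe_iff] using hcpt (b + k)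
  · rintro _ ⟨γ, hγ, rfl⟩
    exact le_trans (b := shiftedPrimalReg F c ε b μ₀ μ₁ ν γ) (le_add_right le_add_self) hγ

end TightSublevels

end UnbalancedOT

open UnbalancedOT in
/-- At `ε = 0` the convention `0 · ∞ = 0` makes this the unregularised problem. -/
theorem mainTheorem10_general {X : Type*} [TopologicalSpace X]
    [TopologicalSpace.MetrizableSpace X] [SecondCountableTopology X] [MeasurableSpace X]
    [BorelSpace X]
    (F : ℝ≥0 → ℝ≥0∞) (hF_convex : ConvexOn ℝ≥0 Set.univ F) (hF_lsc : LowerSemicontinuous F)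
    (c : X × X → EReal) (hc_lsc : LowerSemicontinuous c)
    (hc_bdd : ∃ b : ℝ, ∀ p, (b : EReal) ≤ c p)
    (ε : ℝ) (hε : 0 ≤ ε) (μ₀ μ₁ : FiniteMeasure X) (ν : FiniteMeasure (X × X))
    (hcoercive : (recession F = ⊤ ∧ IsTightMeasureSet {(μ₀ : Measure X)} ∧
        IsTightMeasureSet {(μ₁ : Measure X)}) ∨
      ((∀ k : ℝ, IsCompact {p : X × X | c p ≤ (k : EReal)}) ∧
        0 < ((2 + ε : ℝ) : EReal) * (recession F : EReal) + ⨅ p, c p)) :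
    ∃ γ : FiniteMeasure (X × X), primalReg F c ε μ₀ μ₁ ν γ = UOTReg F c ε μ₀ μ₁ ν := by
  have h2ε : 0 < 2 + ε := by positivity
  obtain ⟨b, hb, hrb⟩ := exists_lower_bound_add_pos (r := (2 + ε : ℝ) * (recession F : EReal))
    (mul_nonneg (EReal.coe_nonneg.2 h2ε.le) (EReal.coe_ennreal_nonneg _)) hc_bdd
    (hcoercive.imp (fun h => by rw [h.1, EReal.coe_ennreal_top, EReal.coe_mul_top_of_pos h2ε])
      And.right)
  obtain ⟨p, hp, hpos⟩ := exists_affineMinorant_mul_add_pos hF_convex hF_lsc h2ε hrb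
  have hmass (T : ℝ) : ∃ M : ℝ≥0, ∀ γ, primalReg F c ε μ₀ μ₁ ν γ ≤ T → γ.mass ≤ M :=
    ⟨_, fun γ hγ => NNReal.le_toNNReal_of_coe_le
      (mass_le_of_primalReg_le hF_convex hF_lsc hc_lsc.measurable hε hb hp hpos hγ)⟩
  refine exists_eq_iInf_of_isTightMeasureSet
    (lowerSemicontinuous_primalReg hF_convex hF_lsc hc_lsc hε hb) hmass fun T => ?_
  obtain ⟨M, hM⟩ := hmass T
  have hsub : {γ | primalReg F c ε μ₀ μ₁ ν γ ≤ T} ⊆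
      {γ | shiftedPrimalReg F c ε b μ₀ μ₁ ν γ ≤ ENNReal.ofReal (T + |b| * M)} := fun γ hγ =>
    shiftedPrimalReg_le_of_primalReg_le hc_lsc.measurable hε hb (hM γ hγ) hγ
  refine IsTightMeasureSet.subset ?_ (Set.image_mono hsub)
  rcases hcoercive with ⟨hrec, hμ₀, hμ₁⟩ | ⟨hcpt, -⟩
  · exact isTightMeasureSet_shiftedPrimalReg_le_of_recession_eq_top hF_convex hF_lsc hrec hμ₀ hμ₁
      ENNReal.ofReal_ne_top
  · exact isTightMeasureSet_shiftedPrimalReg_le_of_isCompact hc_lsc.measurable hcpt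
      ENNReal.ofReal_ne_top

theorem mainTheorem10 {X : Type*} [MetricSpace X] [CompleteSpace X]
    [TopologicalSpace.SeparableSpace X] [MeasurableSpace X] [BorelSpace X]
    (F : ℝ≥0 → ℝ≥0∞) (hF_convex : ConvexOn ℝ≥0 Set.univ F) (hF_lsc : LowerSemicontinuous F)
    (c : X × X → EReal) (hc_lsc : LowerSemicontinuous c)
    (hc_bdd : ∃ b : ℝ, ∀ p, (b : EReal) ≤ c p)
    (ε : ℝ) (hε : 0 < ε)
    (hcoercive : UnbalancedOT.recession F = ⊤ ∨
      ((∀ k : ℝ, IsCompact {p : X × X | c p ≤ (k : EReal)}) ∧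
        0 < ((2 + ε : ℝ) : EReal) * (UnbalancedOT.recession F : EReal) + ⨅ p, c p))
    (μ₀ μ₁ : FiniteMeasure X) (ν : FiniteMeasure (X × X)) :
    ∃ γ : FiniteMeasure (X × X),
      UnbalancedOT.primalReg F c ε μ₀ μ₁ ν γ = UnbalancedOT.UOTReg F c ε μ₀ μ₁ ν := by
  have : SecondCountableTopology X := UniformSpace.secondCountable_of_separable X
  exact mainTheorem10_general F hF_convex hF_lsc c hc_lsc hc_bdd ε hε.le μ₀ μ₁ ν
    (hcoercive.imp_left fun h => ⟨h, isTightMeasureSet_singleton, isTightMeasureSet_singleton⟩)
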